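/- Let $\log$ denote the logarithm to base $2$. A tournament is a directed graph in which every two distinct vertices are joined by exactly one directed edge. In the $k$-tournament game on the complete graph $K_n$, Breaker first fixes an arbitrary tournament $T_k$ on $k$ vertices. Then Maker and Breaker, with Maker moving first, alternately claim a previously unclaimed edge of $K_n$ and choose one of its two orientations, until all edges are claimed. Maker wins if the digraph formed by the edges she claimed and oriented contains a copy of $T_k$; otherwise Breaker wins. Let $k_t(n)$ be the largest $k$ such that Maker has a winning strategy in the $k$-tournament game on $K_n$, that is, a winning strategy for every goal tournament $T_k$. Then, for all sufficiently large $n$, Maker has a winning strategy in the $k$-tournament game on $K_n$ with $k = \lceil 2\log n - 2\log\log n - 12\rceil$, and consequently $$k_t(n) \ \geq\ 2\log n - 2\log\log n - 12 \ =\ (2 - o(1))\log n \qquad (n \to \infty).$$ -/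

import Mathlib

open Filter Topology

namespace TournamentGame

/-- A digraph is a tournament if it has no loops and any two distinct vertices are joined by
exactly one of the two possible arcs. -/
def IsTournament {V : Type*} (T : Digraph V) : Prop :=
  (∀ i, ¬ T.Adj i i) ∧ ∀ i j, i ≠ j → Xor (T.Adj i j) (T.Adj j i)

/-- An ordered pair of vertices of `K_n`; for `u ≠ v` the pair `(u, v)` is the edge `uv` directed
from `u` to `v`. -/
abbrev Arc (n : ℕ) : Type := Fin n × Fin n

/-- A position of the game on `K_n`: the directed edges claimed so far by each of the players. -/
structure Position (n : ℕ) where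
  maker : Finset (Arc n)
  breaker : Finset (Arc n)

/-- The position before the first move. -/
def Position.start (n : ℕ) : Position n := ⟨∅, ∅⟩

/-- The arc `a` may be played: it is an orientation of an edge of `K_n` that no player has
claimed, in either orientation. -/
def Position.Legal {n : ℕ} (P : Position n) (a : Arc n) : Prop :=
  a.1 ≠ a.2 ∧ a ∉ P.maker ∪ P.breaker ∧ a.swap ∉ P.maker ∪ P.breaker

/-- Maker claims an edge with an orientation. -/
def Position.makerMove {n : ℕ} (P : Position n) (a : Arc n) : Position n :=
  ⟨insert a P.maker, P.breaker⟩

/-- Breaker claims an edge with an orientation. -/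
def Position.breakerMove {n : ℕ} (P : Position n) (a : Arc n) : Position n :=
  ⟨P.maker, insert a P.breaker⟩

/-- A strategy (for either player): it names a move in every position, and this move is legal
whenever some edge is still unclaimed. -/
structure Strategy (n : ℕ) where
  move : Position n → Arc n
  legal : ∀ P : Position n, (∃ a, P.Legal a) → P.Legal (move P)

/-- The position after `t` moves, when Maker plays by `σ` and Breaker by `τ`; the players
alternate and Maker moves first. Each of the first `n.choose 2` moves claims a new edge. -/
def play {n : ℕ} (σ τ : Strategy n) : ℕ → Position n
  | 0 => Position.start n
  | t + 1 =>
    if Even t then (play σ τ t).makerMove (σ.move (play σ τ t))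
    else (play σ τ t).breakerMove (τ.move (play σ τ t))

/-- The position at the end of the game, when all `n.choose 2` edges of `K_n` are claimed. -/
def finalPosition {n : ℕ} (σ τ : Strategy n) : Position n := play σ τ (n.choose 2)

/-- The set of arcs `A` contains a copy of the digraph `T`. -/
def ContainsCopy {k n : ℕ} (T : Digraph (Fin k)) (A : Finset (Arc n)) : Prop :=
  ∃ f : Fin k ↪ Fin n, ∀ i j, T.Adj i j → (f i, f j) ∈ A

/-- Maker has a winning strategy on `K_n` for the fixed goal digraph `T`. -/
def MakerWinsGoal {k : ℕ} (T : Digraph (Fin k)) (n : ℕ) : Prop :=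
  ∃ σ : Strategy n, ∀ τ : Strategy n, ContainsCopy T (finalPosition σ τ).maker

/-- Maker has a winning strategy in the `k`-tournament game on `K_n`: whichever goal tournament on
`k` vertices Breaker fixes at the beginning, she has a winning strategy for that goal. -/
def MakerWins (k n : ℕ) : Prop :=
  ∀ T : Digraph (Fin k), IsTournament T → MakerWinsGoal T n

/-- The largest `k` such that Maker has a winning strategy in the `k`-tournament game on `K_n`. -/
noncomputable def kt (n : ℕ) : ℕ := sSup {k | MakerWins k n}

instance (n : ℕ) [Nonempty (Arc n)] : Nonempty (Strategy n) := by
  classical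
  exact ⟨⟨fun P => if h : ∃ a, P.Legal a then h.choose else Classical.arbitrary _,
    fun P h => by rw [dif_pos h]; exact h.choose_spec⟩⟩

theorem le_of_makerWins {k n : ℕ} (hn : 0 < n) (h : MakerWins k n) : k ≤ n := by
  have : Nonempty (Fin n) := ⟨⟨0, hn⟩⟩
  obtain ⟨σ, hσ⟩ := h ⟨fun i j => i < j⟩ ⟨fun i => lt_irrefl i, fun i j hij => by
    rcases lt_or_gt_of_ne hij with h | h
    · exact Or.inl ⟨h, h.not_gt⟩
    · exact Or.inr ⟨h, h.not_gt⟩⟩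
  obtain ⟨f, -⟩ := hσ (Classical.arbitrary _)
  simpa using Fintype.card_le_of_embedding f

/-- For `n ≥ 1` the number `kt n` really is the largest such `k`. -/
theorem isGreatest_kt {n : ℕ} (hn : 0 < n) : IsGreatest {k | MakerWins k n} (kt n) := by
  have : Nonempty (Fin n) := ⟨⟨0, hn⟩⟩
  have hb : BddAbove {k | MakerWins k n} := ⟨n, fun k hk => le_of_makerWins hn hk⟩
  refine ⟨Nat.sSup_mem ⟨0, fun T _ => ⟨Classical.arbitrary _, fun τ => ?_⟩⟩ hb,
    fun k hk => le_csSup hb hk⟩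
  exact ⟨⟨fun i => i.elim0, fun i => i.elim0⟩, fun i => i.elim0⟩

end TournamentGame

/-! Split `k * m` of the vertices into `k` classes of size `m`. Orienting each edge between two
classes as the goal tournament prescribes makes every transversal clique owned by Maker a copy of
the goal. Orientations thus drop out, leaving an undirected Maker-Breaker game whose winning sets
are the transversal cliques.

That game is won by a potential argument in the style of Beck. Let `T` be the expected number of
cliques Maker gets if the free edges are distributed at random. A round with moves `x`, `y` changes
`T` by `T_x - T_y - T_xy`. A greedy choice handles the first two terms, but Breaker may profit from
`T_xy`. Expanding its `p`-th power bounds it by the cluster potential `S`, which counts `p`-tuples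
of cliques sharing two edges. `Promising.exists_move` controls `T` and `S` together, and `T > 0` at
the end means that Maker owns a clique.

Initially `T = X = m ^ k * 2 ^ (-k.choose 2)`. Two common edges span three common vertices, so
building tuples one clique at a time (`sum_clusters_le`) gives `S ≤ X * (X * overlapSum) ^ (p - 1)`.
Up to powers of `k`, `overlapSum` is at most `√2 ^ (-3k)` while `n` is about `√2 ^ k`. The
requirement `n ^ (2p) * overlapSum ^ (p - 1) ≤ 1` then has exponent `2p - 3(p - 1) = 3 - p`, which
is negative from `p = 4` on. -/

/-! ### Potentials and Maker's greedy move in an abstract Maker-Breaker game -/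

namespace MakerBreaker

open Finset

variable {α ι : Type*} [DecidableEq α]

/-- The probability that Maker gets all of `X` if the unclaimed elements are distributed at random,
where `M` and `B` are the sets of elements already claimed by Maker and Breaker. -/
noncomputable def weight (M B X : Finset α) : ℝ :=
  if Disjoint X B then (1 / 2 : ℝ) ^ #(X \ M) else 0

theorem weight_nonneg (M B X : Finset α) : 0 ≤ weight M B X := by
  unfold weight; split_ifs <;> positivity

theorem weight_insert_left {x : α} {M : Finset α} (hx : x ∉ M) (B X : Finset α) :
    weight (insert x M) B X = weight M B X * (1 + if x ∈ X then 1 else 0) := by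
  unfold weight
  split_ifs with hB hX hX
  · have h : #(X \ M) = #(X \ insert x M) + 1 := by
      rw [sdiff_insert, card_erase_add_one (Finset.mem_sdiff.2 ⟨hX, hx⟩)]
    rw [h, pow_succ]; ring
  · rw [sdiff_insert_of_notMem hX]; ring
  · simp
  · simp

theorem weight_insert_right (M B : Finset α) (y : α) (X : Finset α) :
    weight M (insert y B) X = weight M B X * (1 - if y ∈ X then 1 else 0) := by
  unfold weight
  by_cases hy : y ∈ X <;> by_cases hB : Disjoint X B <;> simp [hy, hB]

theorem prod_weight_le {κ : Type*} (M B : Finset α) (s : Finset κ) (A : κ → Finset α) :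
    ∏ j ∈ s, weight M B (A j) ≤ weight M B (s.biUnion A) := by
  by_cases h : ∀ j ∈ s, Disjoint (A j) B
  · have h' : Disjoint (s.biUnion A) B := (disjoint_biUnion_left ..).2 h
    rw [weight, if_pos h', prod_congr rfl fun j hj => by rw [weight, if_pos (h j hj)],
      prod_pow_eq_pow_sum]
    refine pow_le_pow_of_le_one (by norm_num) (by norm_num) ?_
    refine le_trans (card_le_card ?_) card_biUnion_le
    intro z; simp; tauto
  · push Not at h
    obtain ⟨j, hj, hjB⟩ := h
    rw [prod_eq_zero hj (by rw [weight, if_neg hjB])]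
    exact weight_nonneg ..

/-- The expected number of sets of the family `A` that Maker gets if the unclaimed elements are
distributed at random. -/
noncomputable def potential (I : Finset ι) (A : ι → Finset α) (M B : Finset α) : ℝ :=
  ∑ i ∈ I, weight M B (A i)

/-- The part of the potential that is due to the sets containing `x`. -/
noncomputable def potentialAt (I : Finset ι) (A : ι → Finset α) (M B : Finset α) (x : α) : ℝ :=
  ∑ i ∈ I, weight M B (A i) * if x ∈ A i then 1 else 0

/-- The part of the potential that is due to the sets containing both `x` and `y`. -/
noncomputable def potentialAt₂ (I : Finset ι) (A : ι → Finset α) (M B : Finset α) (x y : α) : ℝ :=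
  ∑ i ∈ I, weight M B (A i) * if x ∈ A i ∧ y ∈ A i then 1 else 0

theorem potential_nonneg (I : Finset ι) (A : ι → Finset α) (M B : Finset α) :
    0 ≤ potential I A M B := sum_nonneg fun _ _ => weight_nonneg ..

theorem potentialAt₂_nonneg (I : Finset ι) (A : ι → Finset α) (M B : Finset α) (x y : α) :
    0 ≤ potentialAt₂ I A M B x y :=
  sum_nonneg fun _ _ => mul_nonneg (weight_nonneg ..) (by split_ifs <;> norm_num)

theorem potential_le_insert_left (I : Finset ι) (A : ι → Finset α) {M : Finset α} (B : Finset α)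
    {x : α} (hx : x ∉ M) : potential I A M B ≤ potential I A (insert x M) B := by
  refine sum_le_sum fun i _ => ?_
  rw [weight_insert_left hx]
  refine le_mul_of_one_le_right (weight_nonneg ..) ?_
  split_ifs <;> norm_num

theorem potential_insert_insert (I : Finset ι) (A : ι → Finset α) {M : Finset α} (B : Finset α)
    {x : α} (y : α) (hx : x ∉ M) :
    potential I A (insert x M) (insert y B) = potential I A M B + potentialAt I A M B x
      - potentialAt I A M B y - potentialAt₂ I A M B x y := by
  simp only [potential, potentialAt, potentialAt₂, ← sum_add_distrib, ← sum_sub_distrib]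
  refine sum_congr rfl fun i _ => ?_
  rw [weight_insert_right, weight_insert_left hx]
  by_cases h₁ : x ∈ A i <;> by_cases h₂ : y ∈ A i <;> simp [h₁, h₂]
  ring

variable [Fintype ι]

open Classical in
/-- The `p`-tuples of sets of the family `A` that have at least two elements in common. -/
noncomputable def clusters (p : ℕ) (A : ι → Finset α) : Finset (Fin p → ι) :=
  {t | ∃ x y, x ≠ y ∧ ∀ j, x ∈ A (t j) ∧ y ∈ A (t j)}

/-- The expected number of `p`-tuples in `clusters p A` all of whose sets Maker gets if the
unclaimed elements are distributed at random. -/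
noncomputable def clusterPotential (p : ℕ) (A : ι → Finset α) (M B : Finset α) : ℝ :=
  potential (clusters p A) (fun t => univ.biUnion fun j => A (t j)) M B

/-- Expand the power: the surviving terms are indexed by tuples all of whose sets contain `x` and
`y`, hence by clusters, and a product of weights is at most the weight of the union. -/
theorem potentialAt₂_pow_le (p : ℕ) (A : ι → Finset α) (M B : Finset α) {x y : α} (hxy : x ≠ y) :
    potentialAt₂ univ A M B x y ^ p ≤ clusterPotential p A M B := by
  classical
  unfold potentialAt₂
  rw [← Fin.prod_const, prod_univ_sum, Fintype.piFinset_univ, clusterPotential, potential,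
    ← sum_subset (subset_univ (clusters p A))]
  · refine sum_le_sum fun t _ => le_trans ?_ (prod_weight_le M B univ fun j => A (t j))
    refine prod_le_prod (fun j _ => mul_nonneg (weight_nonneg ..) (by split_ifs <;> norm_num))
      fun j _ => mul_le_of_le_one_right (weight_nonneg ..) (by split_ifs <;> norm_num)
  · intro t _ ht
    simp only [clusters, mem_filter, mem_univ, true_and, not_exists, not_and, not_forall] at ht
    obtain ⟨j, hj⟩ := ht x y hxy
    refine prod_eq_zero (mem_univ j) ?_
    rw [if_neg (by tauto), mul_zero]

/-- The invariant that Maker maintains when `r` elements are unclaimed. -/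
def Promising (p : ℕ) (A : ι → Finset α) (M B : Finset α) (r : ℕ) : Prop :=
  ∃ s : ℝ, 0 < s ∧ clusterPotential p A M B ≤ s ^ p ∧ r * s < potential univ A M B

theorem Promising.potential_pos {p : ℕ} {A : ι → Finset α} {M B : Finset α} {r : ℕ}
    (h : Promising p A M B r) : 0 < potential univ A M B := by
  obtain ⟨s, hs, -, h⟩ := h
  exact lt_of_le_of_lt (by positivity) h

/-- Maker has a move after which, whatever Breaker answers, the invariant is restored. -/
theorem Promising.exists_move {p : ℕ} (hp : 2 ≤ p) {A : ι → Finset α} {M B F : Finset α}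
    (hFM : Disjoint F M) (hF : F.Nonempty) (h : Promising p A M B #F) :
    ∃ x ∈ F, ∀ y ∈ F, y ≠ x → Promising p A (insert x M) (insert y B) (#F - 2) := by
  obtain ⟨s, hs, hS, hT⟩ := h
  obtain ⟨q, rfl⟩ : ∃ q, p = q + 2 := ⟨p - 2, by omega⟩
  set C := clusters (q + 2) A
  set U : (Fin (q + 2) → ι) → Finset α := fun t => univ.biUnion fun j => A (t j)
  -- The derivative of `s ^ p` at `s`: raising the cluster bound by `d` costs about `d / c` in `s`.
  set c : ℝ := (q + 2) * s ^ (q + 1)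
  have hc : 0 < c := by positivity
  -- Maker weighs the gain in potential against the growth of `r * s` caused by the growth of the
  -- cluster potential, with `r` the number of elements left after the round.
  obtain ⟨x, hxF, hx⟩ := F.exists_max_image (fun x => potentialAt univ A M B x -
    ((#F - 2 : ℕ) : ℝ) * (potentialAt C U M B x / c)) hF
  refine ⟨x, hxF, fun y hyF hyx => ?_⟩
  have hxM : x ∉ M := disjoint_left.1 hFM hxF
  have hr : ((#F - 2 : ℕ) : ℝ) + 2 = #F := by
    have : 2 ≤ #F := by
      have := one_lt_card.2 ⟨y, hyF, x, hxF, hyx⟩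
      omega
    push_cast [this]; ring
  set r : ℝ := ((#F - 2 : ℕ) : ℝ)
  have hr0 : 0 ≤ r := Nat.cast_nonneg _
  have key := hx y hyF
  have hTxy : potentialAt₂ univ A M B x y ≤ s :=
    le_of_pow_le_pow_left₀ (by omega) hs.le ((potentialAt₂_pow_le _ A M B hyx.symm).trans hS)
  set d := potentialAt C U M B x - potentialAt C U M B y with hd
  have hS' : clusterPotential (q + 2) A (insert x M) (insert y B) ≤
      clusterPotential (q + 2) A M B + d := by
    have := potential_insert_insert C U B y hxM
    have := potentialAt₂_nonneg C U M B x y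
    change potential C U _ _ ≤ potential C U _ _ + d
    linarith
  have hd' : -(s ^ (q + 2)) ≤ d := by
    have := potential_nonneg C U (insert x M) (insert y B)
    change potential C U _ _ ≤ potential C U _ _ + d at hS'
    change potential C U _ _ ≤ _ at hS
    linarith
  -- The cluster potential stays nonnegative, so `d / (c * s) ≥ -1 / p`; this keeps the new `s`
  -- positive.
  have hdc : -(1 / 2 : ℝ) ≤ d / c / s := by
    have h1 : c * s = (q + 2) * s ^ (q + 2) := by simp only [c]; ring
    rw [div_div, h1, le_div_iff₀ (by positivity)]
    have : 0 ≤ (q : ℝ) * s ^ (q + 2) := by positivity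
    nlinarith
  have hpos : 0 < 1 + d / c / s := by linarith
  -- The new value is `s + d / c`. Bernoulli's inequality bounds its `p`-th power below by `s ^ p +
  -- d`. In the other inequality, two fewer elements free `2 * s`, of which `T_xy` uses at most `s`.
  refine ⟨s * (1 + d / c / s), by positivity, hS'.trans ?_, ?_⟩
  · have hb := one_add_mul_le_pow (a := d / c / s) (by linarith) (q + 2)
    rw [mul_pow]
    have h2 : s ^ (q + 2) * (1 + ((q + 2 : ℕ) : ℝ) * (d / c / s)) = s ^ (q + 2) + d := by
      simp only [c]; push_cast; field_simp; ring
    have := mul_le_mul_of_nonneg_left hb (by positivity : 0 ≤ s ^ (q + 2))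
    linarith
  · rw [potential_insert_insert univ A B y hxM]
    have h3 : r * (s * (1 + d / c / s)) = r * s + (r * (potentialAt C U M B x / c)
        - r * (potentialAt C U M B y / c)) := by
      rw [hd]; field_simp
    rw [h3]
    rw [← hr] at hT
    nlinarith

theorem exists_subset_of_potential_pos {A : ι → Finset α} {M B : Finset α}
    (h : 0 < potential univ A M B) (hA : ∀ i, A i ⊆ M ∪ B) : ∃ i, A i ⊆ M := by
  obtain ⟨i, -, hi⟩ := exists_ne_zero_of_sum_ne_zero h.ne'
  refine ⟨i, fun x hx => ?_⟩
  have : Disjoint (A i) B := by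
    by_contra hB
    exact hi (by rw [weight, if_neg hB])
  exact (mem_union.1 (hA i hx)).resolve_right (disjoint_left.1 this hx)

end MakerBreaker

/-! ### From the abstract game to strategies on `K_n` -/

namespace TournamentGame

open Finset MakerBreaker

variable {n : ℕ}

/-- The undirected edges underlying a set of arcs. -/
def edges (S : Finset (Arc n)) : Finset (Sym2 (Fin n)) := S.image fun a => s(a.1, a.2)

theorem edges_insert (a : Arc n) (S : Finset (Arc n)) :
    edges (insert a S) = insert s(a.1, a.2) (edges S) := image_insert ..

theorem mem_edges {S : Finset (Arc n)} {a : Arc n} :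
    s(a.1, a.2) ∈ edges S ↔ a ∈ S ∨ a.swap ∈ S := by
  obtain ⟨u, v⟩ := a
  simp only [edges, mem_image, Prod.exists, Sym2.eq_iff, Prod.swap_prod_mk]
  constructor
  · rintro ⟨c, d, h, ⟨rfl, rfl⟩ | ⟨rfl, rfl⟩⟩ <;> tauto
  · rintro (h | h)
    exacts [⟨u, v, h, by tauto⟩, ⟨v, u, h, by tauto⟩]

/-- The unclaimed edges. -/
def Position.free (P : Position n) : Finset (Sym2 (Fin n)) :=
  ({e | ¬ e.IsDiag} : Finset (Sym2 (Fin n))) \ (edges P.maker ∪ edges P.breaker)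

theorem Position.legal_iff {P : Position n} {a : Arc n} : P.Legal a ↔ s(a.1, a.2) ∈ P.free := by
  simp only [Position.Legal, Position.free, Finset.mem_sdiff, mem_filter, mem_univ, true_and, mem_union,
    mem_edges, Sym2.mk_isDiag_iff, ne_eq]
  tauto

theorem Position.free_makerMove (P : Position n) (a : Arc n) :
    (P.makerMove a).free = P.free.erase s(a.1, a.2) := by
  ext e
  simp only [Position.free, Position.makerMove, edges_insert, Finset.mem_sdiff, mem_erase, mem_union,
    mem_insert]
  tauto

theorem Position.free_breakerMove (P : Position n) (a : Arc n) :
    (P.breakerMove a).free = P.free.erase s(a.1, a.2) := by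
  ext e
  simp only [Position.free, Position.breakerMove, edges_insert, Finset.mem_sdiff, mem_erase, mem_union,
    mem_insert]
  tauto

theorem Position.card_free_start : #(Position.start n).free = n.choose 2 := by
  have h := Sym2.card_subtype_not_diag (α := Fin n)
  rw [Fintype.card_fin, Fintype.card_subtype] at h
  simpa [Position.free, Position.start, edges] using h

theorem Position.exists_legal {P : Position n} (h : P.free.Nonempty) : ∃ a, P.Legal a := by
  obtain ⟨e, he⟩ := h
  induction e with
  | _ u v => exact ⟨(u, v), Position.legal_iff.2 he⟩

/-- Maker can win the game on the edges of `K_n` with winning sets `A i` if their potential is large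
compared with the cluster potential; moreover she can orient every edge in the way prescribed
by `o`. -/
theorem exists_strategy_of_promising (hn : 0 < n) {p : ℕ} (hp : 2 ≤ p) {ι : Type*} [Fintype ι]
    (A : ι → Finset (Sym2 (Fin n))) (hA : ∀ i, ∀ e ∈ A i, ¬ e.IsDiag)
    (o : Sym2 (Fin n) → Arc n) (ho : ∀ e, s((o e).1, (o e).2) = e)
    (h : Promising p A ∅ ∅ (n.choose 2)) :
    ∃ σ : Strategy n, ∀ τ : Strategy n, ∃ i, ∀ e ∈ A i, o e ∈ (finalPosition σ τ).maker := by
  classical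
  have : Nonempty (Fin n) := ⟨⟨0, hn⟩⟩
  let Good (P : Position n) (a : Arc n) : Prop := P.Legal a ∧ o s(a.1, a.2) = a ∧
    ∀ b ∈ P.free, b ≠ s(a.1, a.2) → Promising p A (insert s(a.1, a.2) (edges P.maker))
      (insert b (edges P.breaker)) (#P.free - 2)
  let σ : Strategy n := ⟨fun P => if h : ∃ a, Good P a then h.choose else
      (Classical.arbitrary (Strategy n)).move P, fun P hP => by
    split_ifs with hG
    · exact hG.choose_spec.1
    · exact (Classical.arbitrary (Strategy n)).legal P hP⟩
  have hσ (P : Position n) (hG : ∃ a, Good P a) : Good P (σ.move P) := by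
    simp only [σ, dif_pos hG]
    exact hG.choose_spec
  refine ⟨σ, fun τ => ?_⟩
  have inv (t : ℕ) (ht : t ≤ n.choose 2) :
      #(play σ τ t).free + t = n.choose 2 ∧
      (∀ a ∈ (play σ τ t).maker, o s(a.1, a.2) = a) ∧
      (Even t → Promising p A (edges (play σ τ t).maker) (edges (play σ τ t).breaker)
        #(play σ τ t).free) ∧
      -- Positivity is recorded separately: if Maker makes the last move, no answer of Breaker
      -- restores the invariant.
      (¬ Even t → 0 < potential univ A (edges (play σ τ t).maker) (edges (play σ τ t).breaker) ∧
        ∀ b ∈ (play σ τ t).free, Promising p A (edges (play σ τ t).maker)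
          (insert b (edges (play σ τ t).breaker)) (#(play σ τ t).free - 1)) := by
    induction t with
    | zero =>
      refine ⟨Position.card_free_start, by simp [play, Position.start], fun _ => ?_, by simp⟩
      rw [play, Position.card_free_start]
      simpa [Position.start, edges] using h
    | succ t ih =>
      obtain ⟨h₁, h₂, h₃, h₄⟩ := ih (by omega)
      rw [play]
      set P := play σ τ t
      have hne : P.free.Nonempty := card_pos.1 (by omega)
      split_ifs with hE
      · have hdisj : Disjoint P.free (edges P.maker) :=
          disjoint_sdiff_self_left.mono_right subset_union_left
        obtain ⟨x, hxF, hx⟩ := (h₃ hE).exists_move hp hdisj hne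
        obtain ⟨hl, hor, hg⟩ := hσ P ⟨o x, Position.legal_iff.2 (by rwa [ho]), by rw [ho],
          by rwa [ho]⟩
        set a := σ.move P
        have haF := Position.legal_iff.1 hl
        have hcard := card_erase_add_one haF
        rw [Position.free_makerMove]
        refine ⟨by omega, ?_, fun h => absurd hE (by simpa [Nat.even_add_one] using h),
          fun _ => ⟨?_, ?_⟩⟩
        · intro b hb
          rcases mem_insert.1 hb with rfl | hb
          exacts [hor, h₂ b hb]
        · simp only [Position.makerMove, edges_insert]
          exact (h₃ hE).potential_pos.trans_le
            (potential_le_insert_left _ _ _ (disjoint_left.1 hdisj haF))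
        · intro b hb
          rw [mem_erase] at hb
          simp only [Position.makerMove, edges_insert]
          rw [show #(P.free.erase s(a.1, a.2)) - 1 = #P.free - 2 by omega]
          exact hg b hb.2 hb.1
      · have haF := Position.legal_iff.1 (τ.legal P (Position.exists_legal hne))
        set a := τ.move P
        have hcard := card_erase_add_one haF
        rw [Position.free_breakerMove]
        refine ⟨by omega, h₂, fun _ => ?_, fun h => absurd (Nat.even_add_one.2 hE) h⟩
        simp only [Position.breakerMove, edges_insert]
        rw [show #(P.free.erase s(a.1, a.2)) = #P.free - 1 by omega]
        exact (h₄ hE).2 _ haF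
  obtain ⟨h₁, h₂, h₃, h₄⟩ := inv _ le_rfl
  change #(finalPosition σ τ).free + _ = _ at h₁
  have hF : (finalPosition σ τ).free = ∅ := card_eq_zero.1 (by omega)
  have hpos : 0 < potential univ A (edges (finalPosition σ τ).maker)
      (edges (finalPosition σ τ).breaker) := by
    by_cases hE : Even (n.choose 2)
    exacts [(h₃ hE).potential_pos, (h₄ hE).1]
  obtain ⟨i, hi⟩ := exists_subset_of_potential_pos hpos fun i e he => by
    by_contra hc
    have : e ∈ (finalPosition σ τ).free :=
      Finset.mem_sdiff.2 ⟨mem_filter.2 ⟨mem_univ _, hA i e he⟩, hc⟩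
    simp [hF] at this
  refine ⟨i, fun e he => ?_⟩
  obtain ⟨a, ha, rfl⟩ := mem_image.1 (hi he)
  rw [h₂ a ha]
  exact ha

end TournamentGame

/-! ### Cluster potential of the transversal cliques -/

namespace TournamentGame

open Finset MakerBreaker

section Pairs

variable {V : Type*} [DecidableEq V]

/-- The edges of the complete graph on the vertex set `S`. -/
def pairs (S : Finset V) : Finset (Sym2 V) := S.offDiag.image fun a => s(a.1, a.2)

theorem mk_mem_pairs {S : Finset V} {x y : V} : s(x, y) ∈ pairs S ↔ x ∈ S ∧ y ∈ S ∧ x ≠ y := by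
  simp only [pairs, mem_image, mem_offDiag, Prod.exists, Sym2.eq_iff]
  constructor
  · rintro ⟨a, b, ⟨ha, hb, hab⟩, ⟨rfl, rfl⟩ | ⟨rfl, rfl⟩⟩
    exacts [⟨ha, hb, hab⟩, ⟨hb, ha, hab.symm⟩]
  · rintro h
    exact ⟨x, y, h, by tauto⟩

theorem card_pairs (S : Finset V) : #(pairs S) = (#S).choose 2 := Sym2.card_image_offDiag S

end Pairs

variable {k m n : ℕ} {v : Fin k × Fin m → Fin n}

/-- The vertex set of the transversal that picks the vertex `g i` of the `i`-th class. -/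
def transversal (v : Fin k × Fin m → Fin n) (g : Fin k → Fin m) : Finset (Fin n) :=
  univ.image fun i => v (i, g i)

theorem card_image_section (hv : Function.Injective v) (g : Fin k → Fin m) (J : Finset (Fin k)) :
    #(J.image fun i => v (i, g i)) = #J :=
  card_image_of_injective _ fun _ _ h => congrArg Prod.fst (hv h)

theorem transversal_inter_biUnion (hv : Function.Injective v) (h : Fin k → Fin m) {q : ℕ}
    (t : Fin q → Fin k → Fin m) :
    transversal v h ∩ univ.biUnion (fun j => transversal v (t j)) =
      ({i | ∃ j, h i = t j i} : Finset (Fin k)).image fun i => v (i, h i) := by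
  ext x
  simp only [transversal, mem_inter, mem_image, mem_univ, true_and, mem_biUnion, mem_filter]
  constructor
  · rintro ⟨⟨i, rfl⟩, j, a, ha⟩
    have := hv ha
    simp only [Prod.mk.injEq] at this
    obtain ⟨rfl, h2⟩ := this
    exact ⟨a, ⟨j, h2.symm⟩, rfl⟩
  · rintro ⟨i, ⟨j, hj⟩, rfl⟩
    exact ⟨⟨i, rfl⟩, j, i, by rw [hj]⟩

/-- An upper bound for the correlation between a random transversal clique and `c` given ones that
have at least three vertices in common with it. -/
noncomputable def overlapSum (c k m : ℕ) : ℝ :=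
  ∑ j ∈ Icc 3 k, (k.choose j : ℝ) * ((c / m : ℝ) ^ j * 2 ^ j.choose 2)

theorem overlapSum_nonneg (c k m : ℕ) : 0 ≤ overlapSum c k m := by
  unfold overlapSum; positivity

theorem card_agree_le {c : ℕ} {q : ℕ} (hq : q ≤ c) (t : Fin q → Fin k → Fin m)
    (J : Finset (Fin k)) :
    #{h : Fin k → Fin m | ∀ i ∈ J, ∃ j, h i = t j i} ≤ c ^ #J * m ^ (k - #J) := by
  classical
  let G (i : Fin k) : Finset (Fin m) := univ.image fun j => t j i
  have hsub : ({h : Fin k → Fin m | ∀ i ∈ J, ∃ j, h i = t j i} : Finset _) ⊆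
      Fintype.piFinset fun i => if i ∈ J then G i else univ := by
    intro h hh
    simp only [mem_filter, mem_univ, true_and] at hh
    rw [Fintype.mem_piFinset]
    intro i
    split_ifs with hi
    · obtain ⟨j, hj⟩ := hh i hi
      exact mem_image.2 ⟨j, mem_univ _, hj.symm⟩
    · exact mem_univ _
  refine (card_le_card hsub).trans ?_
  rw [Fintype.card_piFinset]
  calc ∏ i, #(if i ∈ J then G i else univ) ≤ ∏ i, if i ∈ J then c else m := by
        refine prod_le_prod' fun i _ => ?_
        split_ifs
        · exact (card_image_le.trans (by simp)).trans hq
        · simp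
    _ = c ^ #J * m ^ (k - #J) := by
        rw [prod_ite, prod_const, prod_const]
        congr 2
        · simp
        · rw [filter_not, card_sdiff]; simp

theorem sum_two_pow_agree_le (hm : 0 < m) {c : ℕ} {q : ℕ} (hq : q ≤ c)
    (t : Fin q → Fin k → Fin m) :
    ∑ h : Fin k → Fin m, (if 3 ≤ #{i | ∃ j, h i = t j i} then
        (2 : ℝ) ^ (#{i | ∃ j, h i = t j i}).choose 2 else 0) ≤ m ^ k * overlapSum c k m := by
  classical
  let f (j : ℕ) : ℝ := if 3 ≤ j then 2 ^ j.choose 2 else 0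
  have hf (j : ℕ) : 0 ≤ f j := by simp only [f]; positivity
  calc ∑ h : Fin k → Fin m, f #{i | ∃ j, h i = t j i}
      ≤ ∑ h : Fin k → Fin m, ∑ J : Finset (Fin k),
          if ∀ i ∈ J, ∃ j, h i = t j i then f #J else 0 := by
        refine sum_le_sum fun h _ => ?_
        -- The single term kept is the one where `J` is the whole agreement set of `h`.
        refine le_trans ?_ (single_le_sum (fun J _ => ?_)
          (mem_univ ({i | ∃ j, h i = t j i} : Finset (Fin k))))
        · rw [if_pos (by simp)]
        · split_ifs
          exacts [hf _, le_rfl]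
    _ = ∑ J : Finset (Fin k), #{h : Fin k → Fin m | ∀ i ∈ J, ∃ j, h i = t j i} * f #J := by
        rw [sum_comm]
        refine sum_congr rfl fun J _ => ?_
        rw [← sum_filter, sum_const, nsmul_eq_mul]
    _ ≤ ∑ J : Finset (Fin k), ((c : ℝ) ^ #J * m ^ (k - #J)) * f #J := by
        refine sum_le_sum fun J _ => mul_le_mul_of_nonneg_right ?_ (hf _)
        exact_mod_cast card_agree_le hq t J
    _ = ∑ j ∈ range (k + 1), k.choose j • (((c : ℝ) ^ j * m ^ (k - j)) * f j) := by
        have := sum_powerset_apply_card (x := (univ : Finset (Fin k)))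
          (fun j => ((c : ℝ) ^ j * m ^ (k - j)) * f j)
        rwa [powerset_univ, card_univ, Fintype.card_fin] at this
    _ = m ^ k * overlapSum c k m := by
        rw [overlapSum, mul_sum]
        symm
        calc ∑ j ∈ Icc 3 k, (m : ℝ) ^ k * (k.choose j * ((c / m : ℝ) ^ j * 2 ^ j.choose 2))
            = ∑ j ∈ Icc 3 k, k.choose j • (((c : ℝ) ^ j * m ^ (k - j)) * f j) := by
              refine sum_congr rfl fun j hj => ?_
              rw [Finset.mem_Icc] at hj
              have hmk : (m : ℝ) ^ k = m ^ (k - j) * m ^ j := by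
                rw [← pow_add, Nat.sub_add_cancel hj.2]
              simp only [f, if_pos hj.1, nsmul_eq_mul, hmk, div_pow]
              field_simp
          _ = _ := by
              refine sum_subset (fun j hj => ?_) fun j hj hj' => ?_
              · rw [Finset.mem_Icc] at hj
                exact Finset.mem_range.2 (by omega)
              · rw [Finset.mem_range] at hj
                rw [Finset.mem_Icc] at hj'
                simp only [f]
                rw [if_neg (by omega), mul_zero, smul_zero]

/-- Edges of the new clique that were already covered have both ends among the vertices it shares
with the earlier transversals. -/
theorem card_cons_biUnion (hv : Function.Injective v) (h : Fin k → Fin m) {q : ℕ}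
    (t : Fin q → Fin k → Fin m) :
    #(univ.biUnion fun j => pairs (transversal v (t j))) + k.choose 2 ≤
      #(univ.biUnion fun j : Fin (q + 1) =>
        pairs (transversal v ((Fin.cons h t : Fin (q + 1) → Fin k → Fin m) j)))
      + (#{i | ∃ j, h i = t j i}).choose 2 := by
  set U := univ.biUnion fun j => pairs (transversal v (t j)) with hU
  have h₁ : (univ.biUnion fun j : Fin (q + 1) =>
      pairs (transversal v ((Fin.cons h t : Fin (q + 1) → Fin k → Fin m) j))) =
      U ∪ pairs (transversal v h) := by
    ext e
    simp [hU, Fin.exists_fin_succ, or_comm]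
  have h₂ : #(pairs (transversal v h)) = k.choose 2 := by
    rw [card_pairs, transversal, card_image_section hv, card_univ, Fintype.card_fin]
  have h₃ : U ∩ pairs (transversal v h) ⊆
      pairs (transversal v h ∩ univ.biUnion fun j => transversal v (t j)) := by
    intro e
    induction e with
    | _ x y =>
      simp only [hU, mem_inter, mem_biUnion, mem_univ, true_and, mk_mem_pairs]
      rintro ⟨⟨j, hx, hy, -⟩, hx', hy', hxy⟩
      exact ⟨⟨hx', j, hx⟩, ⟨hy', j, hy⟩, hxy⟩
  have h₄ := card_le_card h₃
  rw [card_pairs, transversal_inter_biUnion hv, card_image_section hv] at h₄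
  have := card_union_add_card_inter U (pairs (transversal v h))
  rw [h₁]
  omega

theorem sum_fin_succ_fun {ι : Type*} [Fintype ι] {q : ℕ} (F : (Fin (q + 1) → ι) → ℝ) :
    ∑ t, F t = ∑ t : Fin q → ι, ∑ i, F (Fin.cons i t : Fin (q + 1) → ι) := by
  rw [← (Fin.consEquiv fun _ => ι).sum_comp, Fintype.sum_prod_type, sum_comm]
  rfl

/-- Induction on the tuple length: each further transversal meets the earlier ones in at least three
vertices, so averaging over it contributes a factor `X * overlapSum`. The number of earlier
transversals never exceeds `c`. -/
theorem sum_clusters_le (hv : Function.Injective v) (hm : 0 < m) {c : ℕ} (q : ℕ) (hq : q ≤ c) :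
    ∑ t : Fin (q + 1) → Fin k → Fin m,
      (if ∃ W, 3 ≤ #W ∧ ∀ j, W ⊆ transversal v (t j) then
        (1 / 2 : ℝ) ^ #(univ.biUnion fun j => pairs (transversal v (t j))) else 0) ≤
      (m ^ k * (1 / 2) ^ k.choose 2) * ((m ^ k * (1 / 2) ^ k.choose 2) * overlapSum c k m) ^ q := by
  classical
  induction q with
  | zero =>
    calc _ ≤ ∑ t : Fin 1 → Fin k → Fin m, (1 / 2 : ℝ) ^ k.choose 2 := by
          refine sum_le_sum fun t _ => ?_
          have : #(univ.biUnion fun j => pairs (transversal v (t j))) = k.choose 2 := by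
            simp [card_pairs, transversal, card_image_section hv]
          rw [this]
          split_ifs
          exacts [le_rfl, by positivity]
      _ = _ := by simp
  | succ q ih =>
    have ih := ih (by omega)
    set X : ℝ := m ^ k * (1 / 2) ^ k.choose 2
    rw [sum_fin_succ_fun]
    calc _ ≤ ∑ t : Fin (q + 1) → Fin k → Fin m,
          (if ∃ W, 3 ≤ #W ∧ ∀ j, W ⊆ transversal v (t j) then
            (1 / 2 : ℝ) ^ #(univ.biUnion fun j => pairs (transversal v (t j))) else 0) *
          ((1 / 2) ^ k.choose 2 * ∑ h : Fin k → Fin m,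
            if 3 ≤ #{i | ∃ j, h i = t j i} then
              (2 : ℝ) ^ (#{i | ∃ j, h i = t j i}).choose 2 else 0) := by
          refine sum_le_sum fun t _ => ?_
          rw [mul_sum, mul_sum]
          refine sum_le_sum fun h _ => ?_
          by_cases hc : ∃ W, 3 ≤ #W ∧ ∀ j,
              W ⊆ transversal v ((Fin.cons h t : Fin (q + 2) → Fin k → Fin m) j)
          · have hcard := card_cons_biUnion hv h t
            have hc' := hc
            obtain ⟨W, hW, hWt⟩ := hc'
            rw [if_pos hc, if_pos ⟨W, hW, fun j => hWt j.succ⟩, if_pos]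
            · rw [one_div, inv_pow, inv_pow, inv_pow, ← mul_assoc, ← mul_inv, ← pow_add,
                inv_mul_eq_div, inv_le_iff_one_le_mul₀ (by positivity), ← mul_div_right_comm,
                le_div_iff₀ (by positivity), ← pow_add, one_mul]
              exact pow_le_pow_right₀ one_le_two (by omega)
            · refine hW.trans ?_
              rw [← card_image_section hv h, ← transversal_inter_biUnion hv h t]
              refine card_le_card (subset_inter (hWt 0) ?_)
              exact Subset.trans (hWt (Fin.succ 0))
                (subset_biUnion_of_mem (fun j => transversal v (t j)) (mem_univ 0))
          · rw [if_neg hc]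
            positivity
      _ ≤ ∑ t : Fin (q + 1) → Fin k → Fin m,
          (if ∃ W, 3 ≤ #W ∧ ∀ j, W ⊆ transversal v (t j) then
            (1 / 2 : ℝ) ^ #(univ.biUnion fun j => pairs (transversal v (t j))) else 0) *
          ((1 / 2) ^ k.choose 2 * (m ^ k * overlapSum c k m)) := by
          gcongr with t
          · exact sum_two_pow_agree_le hm hq t
      _ ≤ X * (X * overlapSum c k m) ^ q * ((1 / 2) ^ k.choose 2 * (m ^ k * overlapSum c k m)) := by
          rw [← sum_mul]
          have := overlapSum_nonneg c k m
          gcongr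
      _ = _ := by simp only [X]; ring

theorem clusterPotential_pairs_le (hv : Function.Injective v) (hm : 0 < m) {c q : ℕ}
    (hq : q ≤ c) :
    clusterPotential (q + 1) (fun g => pairs (transversal v g)) ∅ ∅ ≤
      (m ^ k * (1 / 2) ^ k.choose 2) * ((m ^ k * (1 / 2) ^ k.choose 2) * overlapSum c k m) ^ q := by
  classical
  refine le_trans ?_ (sum_clusters_le hv hm q hq)
  rw [← sum_filter]
  have hsub : clusters (q + 1) (fun g => pairs (transversal v g)) ⊆
      ({t | ∃ W, 3 ≤ #W ∧ ∀ j, W ⊆ transversal v (t j)} :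
        Finset (Fin (q + 1) → Fin k → Fin m)) := by
    intro t ht
    simp only [clusters, mem_filter, mem_univ, true_and] at ht ⊢
    obtain ⟨e, e', hne, he⟩ := ht
    let W : Finset (Fin n) := {x | ∀ j, x ∈ transversal v (t j)}
    have hW (a : Sym2 (Fin n)) (ha : ∀ j, a ∈ pairs (transversal v (t j))) : a ∈ pairs W := by
      induction a with
      | _ x y =>
        simp only [mk_mem_pairs] at ha
        simp only [mk_mem_pairs, W, mem_filter, mem_univ, true_and]
        exact ⟨fun j => (ha j).1, fun j => (ha j).2.1, (ha 0).2.2⟩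
    -- Two distinct common edges need at least three common vertices.
    have hcard : 1 < (#W).choose 2 := by
      rw [← card_pairs]
      exact one_lt_card.2 ⟨e, hW e fun j => (he j).1, e', hW e' fun j => (he j).2, hne⟩
    refine ⟨W, ?_, fun j x hx => (mem_filter.1 hx).2 j⟩
    by_contra hlt
    have : (#W).choose 2 ≤ Nat.choose 2 2 := Nat.choose_le_choose 2 (by omega)
    simp at this
    omega
  unfold clusterPotential potential
  refine (sum_le_sum_of_subset_of_nonneg hsub fun _ _ _ => weight_nonneg ..).trans_eq ?_
  simp [weight]

theorem potential_pairs (hv : Function.Injective v) :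
    potential univ (fun g => pairs (transversal v g)) ∅ ∅ = m ^ k * (1 / 2) ^ k.choose 2 := by
  simp [potential, weight, card_pairs, transversal, card_image_section hv]

theorem makerWins_of_overlapSum_le (hn : 0 < n) (hm : 0 < m) (hkm : k * m ≤ n)
    (h : n ^ 8 * overlapSum 3 k m ^ 3 ≤ 1) : MakerWins k n := by
  intro T hT
  obtain ⟨v⟩ : Nonempty (Fin k × Fin m ↪ Fin n) :=
    Function.Embedding.nonempty_of_card_le (by simpa using hkm)
  have hv := v.injective
  -- The prescribed arcs. No arc is prescribed together with its reverse, so some orientation `o` of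
  -- all edges follows them, arbitrary elsewhere.
  let D (a : Arc n) : Prop := ∃ x y, T.Adj x.1 y.1 ∧ a = (v x, v y)
  have hD (a : Arc n) (h₁ : D a) (h₂ : D a.swap) : False := by
    obtain ⟨x, y, hxy, rfl⟩ := h₁
    obtain ⟨x', y', hxy', h⟩ := h₂
    simp only [Prod.swap_prod_mk, Prod.mk.injEq, EmbeddingLike.apply_eq_iff_eq] at h
    obtain ⟨rfl, rfl⟩ := h
    have hne : x.1 ≠ y.1 := fun h => hT.1 _ (h ▸ hxy)
    rcases hT.2 _ _ hne with h | h
    exacts [h.2 hxy', h.2 hxy]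
  have ho (e : Sym2 (Fin n)) : ∃ a : Arc n, s(a.1, a.2) = e ∧ ∀ b, s(b.1, b.2) = e → D b → b = a := by
    by_cases hb : ∃ b : Arc n, s(b.1, b.2) = e ∧ D b
    · obtain ⟨b, rfl, hb⟩ := hb
      refine ⟨b, rfl, fun b' he hb' => ?_⟩
      rcases Sym2.eq_iff.1 he with h | h
      · exact Prod.ext h.1 h.2
      · have : b' = b.swap := Prod.ext h.1 h.2
        exact (hD b hb (this ▸ hb')).elim
    · induction e with
      | _ x y => exact ⟨(x, y), rfl, fun b he hDb => (hb ⟨b, he, hDb⟩).elim⟩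
  choose o ho ho' using ho
  have hn' : (0 : ℝ) < n := by exact_mod_cast hn
  have hX : (0 : ℝ) < m ^ k * (1 / 2) ^ k.choose 2 := by positivity
  obtain ⟨σ, hσ⟩ := exists_strategy_of_promising hn (p := 4) (by norm_num)
    (fun g : Fin k → Fin m => pairs (transversal v g)) (fun g e => by
      induction e with
      | _ x y => rw [mk_mem_pairs, Sym2.mk_isDiag_iff]; tauto) o ho (by
      -- With `s = X / n ^ 2`, the second condition is `n.choose 2 < n ^ 2`, and the first is the
      -- hypothesis `h`.
      refine ⟨m ^ k * (1 / 2) ^ k.choose 2 / n ^ 2, by positivity, ?_, ?_⟩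
      · refine (clusterPotential_pairs_le hv hm (c := 3) (q := 3) le_rfl).trans ?_
        rw [div_pow _ ((n : ℝ) ^ 2), le_div_iff₀ (by positivity)]
        calc _ = (m ^ k * (1 / 2 : ℝ) ^ k.choose 2) ^ 4 * (n ^ 8 * overlapSum 3 k m ^ 3) := by ring
          _ ≤ _ := mul_le_of_le_one_right (by positivity) h
      · rw [potential_pairs hv, mul_div_assoc', div_lt_iff₀ (by positivity), mul_comm]
        gcongr
        have h₁ : (n.choose 2 : ℝ) ≤ n ^ 2 / (Nat.factorial 2) := Nat.choose_le_pow_div 2 n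
        have h₂ : (0 : ℝ) < n ^ 2 := by positivity
        norm_num at h₁
        linarith)
  refine ⟨σ, fun τ => ?_⟩
  obtain ⟨g, hg⟩ := hσ τ
  refine ⟨⟨fun i => v (i, g i), fun i j h => congrArg Prod.fst (hv h)⟩, fun i j hij => ?_⟩
  have hne : i ≠ j := fun h => hT.1 _ (h ▸ hij)
  have := hg s(v (i, g i), v (j, g j)) (mk_mem_pairs.2 ⟨by simp [transversal], by simp [transversal],
    fun h => hne (congrArg Prod.fst (hv h))⟩)
  rwa [← ho' _ (v (i, g i), v (j, g j)) rfl ⟨_, _, hij, rfl⟩] at this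

end TournamentGame

/-! ### Estimating the overlap sum -/

namespace TournamentGame

open Finset

theorem sqrt_two_pow_two : (√2 : ℝ) ^ 2 = 2 := Real.sq_sqrt (by norm_num)

theorem one_lt_sqrt_two : (1 : ℝ) < √2 := Real.lt_sqrt_of_sq_lt (by norm_num)

theorem two_pow_choose_two (j : ℕ) : (2 : ℝ) ^ j.choose 2 = √2 ^ (j * (j - 1)) := by
  have h : j * (j - 1) = 2 * j.choose 2 := by
    rw [Nat.choose_two_right, Nat.mul_div_cancel' (Nat.even_mul_pred_self j).two_dvd]
  rw [h, pow_mul, sqrt_two_pow_two]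

theorem le_sqrt_two_pow {k e : ℕ} (hk : 2 ^ 57 * (k : ℝ) ^ 20 ≤ √2 ^ k) (he : k ≤ 2 * e + 8) :
    (k : ℝ) ≤ √2 ^ e := by
  rcases Nat.eq_zero_or_pos k with rfl | hk0
  · simp
  have hk1 : (1 : ℝ) ≤ k := by exact_mod_cast hk0
  have h₁ : √2 ^ k ≤ √2 ^ (2 * e + 8) := pow_le_pow_right₀ one_lt_sqrt_two.le he
  have h₂ : √2 ^ (2 * e + 8) = (√2 ^ e) ^ 2 * 2 ^ 4 := by
    rw [pow_add, mul_comm 2 e, pow_mul, pow_mul _ 2 4, sqrt_two_pow_two]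
  have h₃ : (k : ℝ) ^ 2 ≤ k ^ 20 := pow_le_pow_right₀ hk1 (by norm_num)
  refine le_of_sq_le_sq ?_ (by positivity)
  have : (0 : ℝ) ≤ k ^ 20 := by positivity
  linarith

/-- The exponent of `√2` is convex in `j`, so the ends of the range matter. For `2 * j ≤ k` bound
the binomial by `k ^ 3 * k ^ (j - 3)` and each of the last `j - 3` factors by `√2 ^ (k - j - 2)`.
For larger `j` bound it by `k ^ (k - j)` and each factor by `√2 ^ (j - 4)`. -/
theorem choose_mul_sqrt_two_pow_le {k j : ℕ} (hk : 2 ^ 57 * (k : ℝ) ^ 20 ≤ √2 ^ k) (hk9 : 9 ≤ k)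
    (hj : 3 ≤ j) (hjk : j ≤ k) :
    (k.choose j : ℝ) * √2 ^ (j * (j - 1) + 3 * k) ≤ 8 * k ^ 3 * √2 ^ ((k + 4) * j) := by
  have h8 : (8 : ℝ) = √2 ^ 6 := by rw [pow_mul √2 2 3, sqrt_two_pow_two]; norm_num
  have hk1 : (1 : ℝ) ≤ k := by exact_mod_cast (by omega : 1 ≤ k)
  rcases le_or_gt (2 * j) k with h | h
  · obtain ⟨i, rfl⟩ := Nat.exists_eq_add_of_le hj
    obtain ⟨r, rfl⟩ := Nat.exists_eq_add_of_le h
    set k := 2 * (3 + i) + r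
    have hC : (k.choose (3 + i) : ℝ) ≤ k ^ 3 * k ^ i := by
      rw [← pow_add]; exact_mod_cast Nat.choose_le_pow k (3 + i)
    have hi : (k : ℝ) ^ i ≤ √2 ^ ((1 + i + r) * i) := by
      rw [pow_mul]
      exact pow_le_pow_left₀ (by positivity) (le_sqrt_two_pow hk (by omega)) i
    calc (k.choose (3 + i) : ℝ) * √2 ^ ((3 + i) * (3 + i - 1) + 3 * k)
        ≤ k ^ 3 * √2 ^ ((1 + i + r) * i) * √2 ^ ((3 + i) * (3 + i - 1) + 3 * k) := by
          gcongr
          exact hC.trans (by gcongr)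
      _ = k ^ 3 * √2 ^ ((1 + i + r) * i + ((3 + i) * (3 + i - 1) + 3 * k)) := by
          rw [mul_assoc, ← pow_add]
      _ ≤ k ^ 3 * √2 ^ (6 + (k + 4) * (3 + i)) := by
          refine mul_le_mul_of_nonneg_left (pow_le_pow_right₀ one_lt_sqrt_two.le ?_) (by positivity)
          rw [show 3 + i - 1 = 2 + i by omega]
          simp only [k]
          nlinarith
      _ = _ := by rw [h8, pow_add]; ring
  · obtain ⟨d, rfl⟩ := Nat.exists_eq_add_of_le hjk
    obtain ⟨e, rfl⟩ := Nat.exists_eq_add_of_le (by omega : 4 ≤ j)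
    set k := 4 + e + d
    have hC : (k.choose (4 + e) : ℝ) ≤ k ^ d := by
      rw [Nat.choose_symm_add]; exact_mod_cast Nat.choose_le_pow k d
    have hd : (k : ℝ) ^ d ≤ √2 ^ (e * d) := by
      rw [pow_mul]
      exact pow_le_pow_left₀ (by positivity) (le_sqrt_two_pow hk (by omega)) d
    have h8k : (1 : ℝ) ≤ 8 * k ^ 3 := by
      have := one_le_pow₀ hk1 (n := 3)
      linarith
    calc (k.choose (4 + e) : ℝ) * √2 ^ ((4 + e) * (4 + e - 1) + 3 * k)
        ≤ √2 ^ (e * d) * √2 ^ ((4 + e) * (4 + e - 1) + 3 * k) := by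
          gcongr
          exact hC.trans hd
      _ = √2 ^ (e * d + ((4 + e) * (4 + e - 1) + 3 * k)) := by rw [← pow_add]
      _ ≤ √2 ^ ((k + 4) * (4 + e)) := by
          refine pow_le_pow_right₀ one_lt_sqrt_two.le ?_
          rw [show 4 + e - 1 = 3 + e by omega]
          simp only [k]
          nlinarith
      _ ≤ _ := le_mul_of_one_le_left (by positivity) h8k

theorem overlapSum_le {k m : ℕ} (hk : 2 ^ 57 * (k : ℝ) ^ 20 ≤ √2 ^ k) (hk9 : 9 ≤ k)
    (hm : 16 * √2 ^ k ≤ m) : overlapSum 3 k m ≤ 8 * k ^ 4 / √2 ^ (3 * k) := by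
  have hterm (j : ℕ) (hj : j ∈ Icc 3 k) : (k.choose j : ℝ) * (((3 : ℕ) / m : ℝ) ^ j * 2 ^ j.choose 2)
      ≤ 8 * k ^ 3 / √2 ^ (3 * k) := by
    rw [Finset.mem_Icc] at hj
    have h4 : √2 ^ 4 = 4 := by rw [pow_mul √2 2 2, sqrt_two_pow_two]; norm_num
    -- The factor 16 in `hm` suffices because `3 * √2 ^ 4 = 12`.
    have h3m : ((3 : ℕ) / m : ℝ) ≤ 1 / √2 ^ (k + 4) := by
      have : (0 : ℝ) < √2 ^ k := by positivity
      have hm0 : (0 : ℝ) < m := by linarith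
      rw [div_le_div_iff₀ hm0 (by positivity), pow_add, h4]
      push_cast
      linarith
    calc _ ≤ (k.choose j : ℝ) * ((1 / √2 ^ (k + 4)) ^ j * √2 ^ (j * (j - 1))) := by
          rw [two_pow_choose_two]
          gcongr
      _ = (k.choose j : ℝ) * √2 ^ (j * (j - 1) + 3 * k) / √2 ^ ((k + 4) * j) / √2 ^ (3 * k) := by
          rw [pow_add _ (j * (j - 1)), pow_mul _ (k + 4), one_div, inv_pow]
          field_simp
      _ ≤ _ := by
          gcongr
          rw [div_le_iff₀ (by positivity)]
          exact choose_mul_sqrt_two_pow_le hk hk9 hj.1 hj.2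
  refine (sum_le_card_nsmul _ _ _ hterm).trans ?_
  have hcard : ((#(Icc 3 k) : ℕ) : ℝ) ≤ k := by
    rw [Nat.card_Icc]; exact_mod_cast (by omega : k + 1 - 3 ≤ k)
  rw [nsmul_eq_mul]
  calc _ ≤ (k : ℝ) * (8 * k ^ 3 / √2 ^ (3 * k)) := by gcongr
    _ = _ := by ring

theorem makerWins_of_le {k n : ℕ} (hk : 2 ^ 57 * (k : ℝ) ^ 20 ≤ √2 ^ k) (hk9 : 9 ≤ k)
    (hn : (n : ℝ) ≤ 64 * k * √2 ^ k) (hkn : k * (16 * √2 ^ k + 1) ≤ n) : MakerWins k n := by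
  set m := ⌈16 * √2 ^ k⌉₊
  have hθ : (0 : ℝ) < √2 ^ k := by positivity
  have hk0 : (0 : ℝ) < k := by exact_mod_cast (by omega : 0 < k)
  have hm : 16 * √2 ^ k ≤ m := Nat.le_ceil _
  have hm' : (m : ℝ) < 16 * √2 ^ k + 1 := Nat.ceil_lt_add_one (by positivity)
  have hm0 : 0 < m := Nat.ceil_pos.2 (by positivity)
  have hn0 : 0 < n := by
    have : (0 : ℝ) < n := lt_of_lt_of_le (by positivity) hkn
    exact_mod_cast this
  refine makerWins_of_overlapSum_le hn0 hm0 ?_ ?_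
  · have : (k : ℝ) * m ≤ n := le_trans (by gcongr) hkn
    exact_mod_cast this
  · have := overlapSum_nonneg 3 k m
    calc (n : ℝ) ^ 8 * overlapSum 3 k m ^ 3
        ≤ (64 * k * √2 ^ k) ^ 8 * (8 * k ^ 4 / √2 ^ (3 * k)) ^ 3 := by
          gcongr
          exact overlapSum_le hk hk9 hm
      _ = 2 ^ 57 * (k : ℝ) ^ 20 / √2 ^ k := by
          rw [mul_comm 3 k, pow_mul]
          field_simp
          ring
      _ ≤ 1 := (div_le_one hθ).2 hk

/-! ### Asymptotics and the choice of `k` -/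

theorem tendsto_logb_div_atTop : Tendsto (fun y : ℝ => Real.logb 2 y / y) atTop (𝓝 0) := by
  have := Real.isLittleO_log_id_atTop.tendsto_div_nhds_zero.div_const (Real.log 2)
  rw [zero_div] at this
  refine this.congr fun y => ?_
  simp only [Real.logb, id]
  ring

theorem eventually_logb_le {c : ℝ} (hc : 0 < c) : ∀ᶠ y : ℝ in atTop, Real.logb 2 y ≤ c * y := by
  filter_upwards [tendsto_logb_div_atTop.eventually_le_const hc, eventually_gt_atTop 0]
    with y hy hy0
  exact (div_le_iff₀ hy0).1 hy

theorem sqrt_two_pow_eq (k : ℕ) : √2 ^ k = (2 : ℝ) ^ ((k : ℝ) / 2) := by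
  rw [Real.sqrt_eq_rpow, ← Real.rpow_natCast, ← Real.rpow_mul (by norm_num)]
  congr 1
  ring

theorem tendsto_logb_natCast : Tendsto (fun n : ℕ => Real.logb 2 (n : ℝ)) atTop atTop :=
  (Real.tendsto_logb_atTop one_lt_two).comp tendsto_natCast_atTop_atTop

theorem eventually_logb_le_sub : ∀ᶠ n : ℕ in atTop, Real.logb 2 (n : ℝ) ≤
    2 * Real.logb 2 (n : ℝ) - 2 * Real.logb 2 (Real.logb 2 (n : ℝ)) - 12 := by
  filter_upwards [tendsto_logb_natCast.eventually (eventually_logb_le (c := 1 / 4) (by norm_num)),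
    tendsto_logb_natCast.eventually_ge_atTop 24] with n h₁ h₂
  linarith

theorem eventually_makerWins : ∀ᶠ n : ℕ in atTop, MakerWins
    ⌈2 * Real.logb 2 (n : ℝ) - 2 * Real.logb 2 (Real.logb 2 (n : ℝ)) - 12⌉₊ n := by
  have hceil : Tendsto (fun n : ℕ =>
      ⌈2 * Real.logb 2 (n : ℝ) - 2 * Real.logb 2 (Real.logb 2 (n : ℝ)) - 12⌉₊) atTop atTop :=
    tendsto_nat_ceil_atTop.comp (tendsto_atTop_mono' _ eventually_logb_le_sub tendsto_logb_natCast)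
  have hpow : ∀ᶠ k : ℕ in atTop, 2 ^ 57 * (k : ℝ) ^ 20 ≤ √2 ^ k := by
    filter_upwards [(tendsto_pow_const_div_const_pow_of_one_lt 20 one_lt_sqrt_two).eventually_le_const
      (by positivity : (0 : ℝ) < 1 / 2 ^ 57)] with k hk
    rw [div_le_iff₀ (by positivity)] at hk
    linarith
  filter_upwards [eventually_logb_le_sub, hceil.eventually hpow, hceil.eventually_ge_atTop 9,
    tendsto_logb_natCast.eventually_ge_atTop 1, eventually_gt_atTop 0,
    tendsto_natCast_atTop_atTop.eventually (eventually_logb_le (c := 1 / 8) (by norm_num))]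
    with n hx hk hk9 hL hn hLn
  set L := Real.logb 2 (n : ℝ)
  set x := 2 * L - 2 * Real.logb 2 L - 12 with hxdef
  have hn0 : (0 : ℝ) < n := by exact_mod_cast hn
  have hL0 : 0 < L := by linarith
  have hkx : x ≤ ⌈x⌉₊ := Nat.le_ceil x
  have hkx' : (⌈x⌉₊ : ℝ) < x + 1 := Nat.ceil_lt_add_one (by linarith)
  have hlogL : 0 ≤ Real.logb 2 L := Real.logb_nonneg one_lt_two hL
  -- The constant 12 becomes the factor `2 ^ 6 = 64`, which makes room for `k` classes of size about
  -- `16 * √2 ^ k`: with `k ≤ 2 * L` and rounding loss `√2 ≤ 3 / 2` they take `3 / 4 * n + 2 * L`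
  -- vertices at most.
  have hpowx : (2 : ℝ) ^ (x / 2) = n / L / 64 := by
    rw [show x / 2 = L - Real.logb 2 L - (6 : ℕ) by rw [hxdef]; push_cast; ring,
      Real.rpow_sub (by norm_num), Real.rpow_sub (by norm_num),
      Real.rpow_logb (by norm_num) (by norm_num) hn0,
      Real.rpow_logb (by norm_num) (by norm_num) hL0, Real.rpow_natCast]
    norm_num
  have hlow : n / L / 64 ≤ √2 ^ ⌈x⌉₊ := by
    rw [← hpowx, sqrt_two_pow_eq]
    exact Real.rpow_le_rpow_of_exponent_le one_le_two (by linarith)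
  have hupp : √2 ^ ⌈x⌉₊ ≤ n / L / 64 * (3 / 2) := by
    have hsqrt : √2 ≤ 3 / 2 := Real.sqrt_le_iff.2 (by norm_num)
    calc √2 ^ ⌈x⌉₊ ≤ (2 : ℝ) ^ (x / 2 + 1 / 2) := by
          rw [sqrt_two_pow_eq]
          exact Real.rpow_le_rpow_of_exponent_le one_le_two (by linarith)
      _ = n / L / 64 * √2 := by rw [Real.rpow_add two_pos, hpowx, Real.sqrt_eq_rpow]
      _ ≤ _ := by gcongr
  refine makerWins_of_le hk hk9 ?_ ?_
  · calc (n : ℝ) = 64 * L * (n / L / 64) := by field_simp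
      _ ≤ 64 * ⌈x⌉₊ * √2 ^ ⌈x⌉₊ := by
        gcongr
        linarith
  · calc (⌈x⌉₊ : ℝ) * (16 * √2 ^ ⌈x⌉₊ + 1) ≤ (2 * L) * (16 * (n / L / 64 * (3 / 2)) + 1) := by
          gcongr
          linarith
      _ = 3 / 4 * n + 2 * L := by field_simp; ring
      _ ≤ n := by linarith

end TournamentGame

theorem theorem2 :
    (∀ᶠ n : ℕ in atTop,
      TournamentGame.MakerWins
        ⌈2 * Real.logb 2 (n : ℝ) - 2 * Real.logb 2 (Real.logb 2 (n : ℝ)) - 12⌉₊ n ∧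
      2 * Real.logb 2 (n : ℝ) - 2 * Real.logb 2 (Real.logb 2 (n : ℝ)) - 12
        ≤ (TournamentGame.kt n : ℝ)) ∧
    ∃ ε : ℕ → ℝ, Tendsto ε atTop (𝓝 0) ∧
      ∀ᶠ n : ℕ in atTop,
        2 * Real.logb 2 (n : ℝ) - 2 * Real.logb 2 (Real.logb 2 (n : ℝ)) - 12
          = (2 - ε n) * Real.logb 2 (n : ℝ) := by
  refine ⟨?_, fun n => 2 * (Real.logb 2 (Real.logb 2 (n : ℝ)) / Real.logb 2 (n : ℝ))
    + 12 / Real.logb 2 (n : ℝ), ?_, ?_⟩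
  · filter_upwards [TournamentGame.eventually_makerWins, eventually_gt_atTop 0] with n h hn
    refine ⟨h, (Nat.le_ceil _).trans ?_⟩
    exact_mod_cast (TournamentGame.isGreatest_kt hn).2 h
  · have h₁ := (TournamentGame.tendsto_logb_div_atTop.comp
      TournamentGame.tendsto_logb_natCast).const_mul 2
    have h₂ := TournamentGame.tendsto_logb_natCast.const_div_atTop 12
    simpa using h₁.add h₂
  · filter_upwards [TournamentGame.tendsto_logb_natCast.eventually_gt_atTop 0] with n hn
    field_simp
    ring
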